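/- Let $m\ge 2$ and let $O\subset\mathbb{R}^m$ be a nonempty compact strictly convex set with $C^\infty$ boundary (that is, near each boundary point $O$ is the set $\{\rho\le 0\}$ for a $C^\infty$ function $\rho$ whose derivative does not vanish at that point), contained in some closed ball of radius smaller than $\sqrt2/4$. Consider the billiard on the torus $\mathbb{T}^m=\mathbb{R}^m/\mathbb{Z}^m$ with the obstacle $O$, lifted to $\mathbb{R}^m$, where the obstacles are $O_{\mathbf k}=O+\mathbf k$, $\mathbf k\in\mathbb{Z}^m$. A \emph{trajectory piece} is a polygonal path in $\mathbb{R}^m$ with finitely many, and at least one, nondegenerate segments, which avoids the interiors of all obstacles and whose intermediate vertices $\mathbf x$ are non-tangential specular reflections: $\mathbf x$ lies on the boundary of some $O_{\mathbf k}$ and the incoming and outgoing unit directions $\mathbf u,\mathbf v$ satisfy $\langle \mathbf u,\nu\rangle<0$ and $\mathbf v=\mathbf u-2\langle\mathbf u,\nu\rangle\nu$, where $\nu$ is the outer unit normal to $O_{\mathbf k}$ at $\mathbf x$. (Tangencies are not counted as reflections.) A trajectory piece with vertices $\mathbf x_0,\dots,\mathbf x_s$ has \emph{type} $(\mathbf k_n)_{n=0}^s$,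 $\mathbf k_n\in\mathbb{Z}^m$, if it starts on the boundary of $O_{\mathbf k_0}$, reflects at $\mathbf x_n$ from $O_{\mathbf k_n}$ for $0<n<s$, and ends on the boundary of $O_{\mathbf k_s}$. The obstacle $O_{\mathbf k}$ is \emph{between} $O_{\mathbf i}$ and $O_{\mathbf j}$ if $\mathbf k\ne\mathbf i,\mathbf j$ and $O_{\mathbf k}$ intersects the convex hull of $O_{\mathbf i}\cup O_{\mathbf j}$. A finite sequence $(\mathbf k_n)_{n=0}^s$ in $\mathbb{Z}^m$ is \emph{admissible} if $\mathbf k_0=\mathbf 0$; $\mathbf k_{n+1}\ne\mathbf k_n$ for $0\le n<s$; no obstacle is between $O_{\mathbf k_n}$ and $O_{\mathbf k_{n+1}}$ for $0\le n<s$; and $O_{\mathbf k_{n+1}}$ is not between $O_{\mathbf k_n}$ and $O_{\mathbf k_{n+2}}$ for $0\le n\le s-2$. The \emph{rotation set} $R\subset\mathbb{R}^m$ consists of all limits of sequences $\big((\mathbf y_n-\mathbf x_n)/t_n\big)_n$ such that for each $n$ there is a trajectory piece from $\mathbf x_n$ to $\mathbf y_n$ of length $t_n$, and $t_n\to\infty$.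 The \emph{admissible rotation set} $AR$ is defined in the same way, using only trajectory pieces of admissible type. Then $AR$ is contained in the open unit ball centered at the origin, $(1,0,\dots,0)\in R$, and hence $AR\ne R$. -/

import Mathlib

open Set Filter Topology
open scoped ContDiff

namespace TorusBilliard

/-- Euclidean `m`-space, the universal cover of the torus `ℝᵐ / ℤᵐ`. -/
abbrev Space (m : ℕ) : Type := EuclideanSpace ℝ (Fin m)

/-- The lattice `ℤᵐ`. -/
abbrev Lattice (m : ℕ) : Type := Fin m → ℤ

/-- An integer vector viewed as a point of `ℝᵐ`. -/
def toSpace {m : ℕ} (k : Lattice m) : Space m := WithLp.toLp 2 (fun i => (k i : ℝ))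

/-- The boundary of `O` is a smooth hypersurface with `O` on one side: near each boundary point,
`O` is the sublevel set of a `C^∞` function with nonvanishing derivative at that point. -/
def HasSmoothBoundary {m : ℕ} (O : Set (Space m)) : Prop :=
  ∀ p ∈ frontier O, ∃ (U : Set (Space m)) (ρ : Space m → ℝ),
    IsOpen U ∧ p ∈ U ∧ ContDiffOn ℝ ∞ ρ U ∧ fderiv ℝ ρ p ≠ 0 ∧ ∀ x ∈ U, (x ∈ O ↔ ρ x ≤ 0)

/-- (A lift to `ℝᵐ` of) a strictly convex obstacle with smooth boundary. -/
structure IsObstacle {m : ℕ} (O : Set (Space m)) : Prop where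
  nonempty : O.Nonempty
  isCompact : IsCompact O
  strictConvex : StrictConvex ℝ O
  smoothBoundary : HasSmoothBoundary O

/-- The obstacle is contained in a closed ball of radius smaller than `√2 / 4`. -/
def IsSmall {m : ℕ} (O : Set (Space m)) : Prop :=
  ∃ (c : Space m) (r : ℝ), r < √2 / 4 ∧ O ⊆ Metric.closedBall c r

/-- The lifted obstacle `O_k`, the translate of `O` by `k ∈ ℤᵐ`. -/
def lift {m : ℕ} (O : Set (Space m)) (k : Lattice m) : Set (Space m) :=
  (fun x => x + toSpace k) '' O

/-- `O_k` is between `O_i` and `O_j`. -/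
def IsBetween {m : ℕ} (O : Set (Space m)) (k i j : Lattice m) : Prop :=
  k ≠ i ∧ k ≠ j ∧ (lift O k ∩ convexHull ℝ (lift O i ∪ lift O j)).Nonempty

/-- The finite sequence `k 0, …, k s` is admissible (values of `k` beyond `s` are ignored). -/
def IsAdmissible {m : ℕ} (O : Set (Space m)) (s : ℕ) (k : ℕ → Lattice m) : Prop :=
  k 0 = 0 ∧
  (∀ n, n + 1 ≤ s → k (n + 1) ≠ k n) ∧
  (∀ n, n + 1 ≤ s → ∀ l, ¬ IsBetween O l (k n) (k (n + 1))) ∧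
  (∀ n, n + 2 ≤ s → ¬ IsBetween O (k (n + 1)) (k n) (k (n + 2)))

/-- `ν` is an outer unit normal at the boundary point `x` of the convex set `C` (for a convex body
with smooth boundary it is the unique one). -/
def IsOuterUnitNormal {m : ℕ} (C : Set (Space m)) (x ν : Space m) : Prop :=
  x ∈ frontier C ∧ ‖ν‖ = 1 ∧ ∀ y ∈ C, inner ℝ ν (y - x) ≤ 0

/-- The unit direction from `x` to `y` (used for `x ≠ y`). -/
noncomputable def direction {m : ℕ} (x y : Space m) : Space m := ‖y - x‖⁻¹ • (y - x)

/-- The path `x → y → z` has a (non-tangential, specular) reflection at `y` from the outside of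
the obstacle `C`. -/
def ReflectsAt {m : ℕ} (C : Set (Space m)) (x y z : Space m) : Prop :=
  ∃ ν : Space m, IsOuterUnitNormal C y ν ∧ inner ℝ (direction x y) ν < 0 ∧
    direction y z = direction x y - (2 * inner ℝ (direction x y) ν) • ν

/-- The polygonal path `x 0, …, x s` is a billiard trajectory piece in the lifting: its `s ≥ 1`
nondegenerate segments avoid the interiors of all obstacles, and its intermediate vertices are
exactly its reflections. The end points are arbitrary, and a tangency is not a reflection: the
trajectory passes through it along a straight line. -/
def IsTrajectoryPiece {m : ℕ} (O : Set (Space m)) (s : ℕ) (x : ℕ → Space m) : Prop :=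
  1 ≤ s ∧
  (∀ i < s, x i ≠ x (i + 1) ∧
    ∀ k : Lattice m, Disjoint (segment ℝ (x i) (x (i + 1))) (interior (lift O k))) ∧
  (∀ i, i + 1 < s → ∃ k : Lattice m, ReflectsAt (lift O k) (x i) (x (i + 1)) (x (i + 2)))

/-- The trajectory piece `x 0, …, x s` has type `k 0, …, k s`: it starts on the boundary of
`O_{k 0}`, reflects consecutively from `O_{k 1}, …, O_{k (s-1)}`, and ends on the boundary of
`O_{k s}`. -/
def HasType {m : ℕ} (O : Set (Space m)) (s : ℕ) (x : ℕ → Space m) (k : ℕ → Lattice m) : Prop :=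
  x 0 ∈ frontier (lift O (k 0)) ∧ x s ∈ frontier (lift O (k s)) ∧
  ∀ i, i + 1 < s → ReflectsAt (lift O (k (i + 1))) (x i) (x (i + 1)) (x (i + 2))

/-- Length of the path `x 0, …, x s`. -/
noncomputable def pathLength {m : ℕ} (s : ℕ) (x : ℕ → Space m) : ℝ :=
  ∑ i ∈ Finset.range s, ‖x (i + 1) - x i‖

/-- All limits of displacement divided by length, along sequences of paths in the class `P` whose
lengths go to infinity. -/
def limitVectors {m : ℕ} (P : ℕ → (ℕ → Space m) → Prop) : Set (Space m) :=
  {v | ∃ (s : ℕ → ℕ) (x : ℕ → ℕ → Space m),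
    (∀ n, P (s n) (x n)) ∧
    Tendsto (fun n => pathLength (s n) (x n)) atTop atTop ∧
    Tendsto (fun n => (pathLength (s n) (x n))⁻¹ • (x n (s n) - x n 0)) atTop (𝓝 v)}

/-- The rotation set `R`. -/
def rotationSet {m : ℕ} (O : Set (Space m)) : Set (Space m) :=
  limitVectors (fun s x => IsTrajectoryPiece O s x)

/-- The admissible rotation set `AR`: only trajectory pieces of admissible type are used. -/
def admissibleRotationSet {m : ℕ} (O : Set (Space m)) : Set (Space m) :=
  limitVectors (fun s x => IsTrajectoryPiece O s x ∧
    ∃ k : ℕ → Lattice m, IsAdmissible O s k ∧ HasType O s x k)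

end TorusBilliard

namespace TorusBilliard

variable {m : ℕ}

/-! An obstacle has interior, so over a long lattice vector some translate meets the hull of the two
end obstacles; hence admissible steps are bounded (`exists_bound_of_not_isBetween`). Up to
translation only finitely many triples of consecutive obstacles remain. In each, no point of the
middle obstacle lies on a segment joining the outer two, so compactness gives one `δ > 0` lost at
every corner (`exists_uniform_triangle_defect`). Bounded steps force the number of corners to grow
linearly with the length, so displacement over length stays below 1 by a fixed amount. A line in a
coordinate direction halfway between rows of obstacles meets none of them and has speed 1. -/

theorem toSpace_add (a b : Lattice m) : toSpace (a + b) = toSpace a + toSpace b := by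
  ext i; simp [toSpace]

theorem toSpace_sub (a b : Lattice m) : toSpace (a - b) = toSpace a - toSpace b := by
  ext i; simp [toSpace]

theorem mem_lift_iff {O : Set (Space m)} {k : Lattice m} {x : Space m} :
    x ∈ lift O k ↔ x - toSpace k ∈ O := by
  constructor
  · rintro ⟨y, hy, rfl⟩
    simpa using hy
  · intro h
    exact ⟨_, h, by simp⟩

theorem IsObstacle.frontier_lift_subset {O : Set (Space m)} (hO : IsObstacle O) (k : Lattice m) :
    frontier (lift O k) ⊆ lift O k :=
  (hO.isCompact.image (by fun_prop : Continuous fun x : Space m => x + toSpace k)).isClosed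
    |>.frontier_subset

/-- Two distinct points have an interior midpoint by strict convexity. A single point would be a
local minimum of its `ρ`, against the nonvanishing derivative. -/
theorem IsObstacle.interior_nonempty {O : Set (Space m)} (hO : IsObstacle O) :
    (interior O).Nonempty := by
  obtain ⟨p, hp⟩ := hO.nonempty
  by_cases h : ∃ q ∈ O, p ≠ q
  · obtain ⟨q, hq, hpq⟩ := h
    exact ⟨_, hO.strictConvex hp hq hpq (a := 1 / 2) (b := 1 / 2) (by norm_num) (by norm_num)
      (by norm_num)⟩
  · push Not at h
    by_contra hne
    rw [Set.not_nonempty_iff_eq_empty] at hne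
    have hpf : p ∈ frontier O := ⟨subset_closure hp, by simp [hne]⟩
    obtain ⟨U, ρ, hU, hpU, -, hρ, hUO⟩ := hO.smoothBoundary p hpf
    refine hρ (IsLocalMin.fderiv_eq_zero ?_)
    filter_upwards [hU.mem_nhds hpU] with x hx
    by_cases hxO : x ∈ O
    · rw [← h x hxO]
    · have h1 : ¬ ρ x ≤ 0 := fun h' => hxO ((hUO x hx).2 h')
      have h2 := (hUO p hpU).1 hp
      linarith

/-! ### Bounded length of admissible steps -/

/-- Among sufficiently many equidistant points of a long segment, two are close modulo `ℤᵐ`. -/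
theorem exists_lattice_near (m : ℕ) {ε : ℝ} (hε : 0 < ε) :
    ∃ N : ℝ, 0 < N ∧ ∀ d : Space m, ∃ (τ : ℝ) (l : Lattice m),
      1 / N ≤ τ ∧ τ ≤ 1 - 1 / N ∧ ‖toSpace l - τ • d‖ < ε := by
  let K : Set (Space m) := WithLp.toLp 2 '' Icc (0 : Fin m → ℝ) 1
  have hK : IsCompact K := isCompact_Icc.image (PiLp.continuous_toLp 2 _)
  obtain ⟨T, hT, hKT⟩ := Metric.totallyBounded_iff.1 hK.totallyBounded (ε / 2) (by positivity)
  let n := hT.toFinset.card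
  refine ⟨n + 1, by positivity, fun d => ?_⟩
  -- Pigeonhole: the `n + 1` points `t / (n + 1) • d`, reduced to the unit cube, fall into `n` balls
  -- of radius `ε / 2`.
  let fl : ℕ → Lattice m := fun t j => ⌊((t : ℝ) / (n + 1)) * d j⌋
  let F : ℕ → Space m := fun t => ((t : ℝ) / (n + 1)) • d - toSpace (fl t)
  have hF : ∀ t, ∃ y ∈ hT.toFinset, dist (F t) y < ε / 2 := by
    intro t
    have : F t ∈ K := by
      refine ⟨fun j => Int.fract (((t : ℝ) / (n + 1)) * d j), ⟨fun j => Int.fract_nonneg _,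
        fun j => (Int.fract_lt_one _).le⟩, ?_⟩
      ext j
      simp [F, fl, toSpace]
    simpa using hKT this
  choose y hyT hy using hF
  obtain ⟨a, ha, b, hb, hab, hyab⟩ := Finset.exists_ne_map_eq_of_card_lt_of_maps_to
    (s := Finset.range (n + 1)) (t := hT.toFinset) (f := y) (by simp [n])
    (fun t _ => hyT t)
  wlog hlt : a < b generalizing a b
  · exact this b hb a ha hab.symm hyab.symm (by omega)
  rw [Finset.mem_range] at hb
  refine ⟨((b : ℝ) - a) / (n + 1), fl b - fl a, ?_, ?_, ?_⟩
  · have : (a : ℝ) + 1 ≤ b := by exact_mod_cast hlt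
    gcongr; linarith
  · have : (b : ℝ) + 1 ≤ n + 1 := by exact_mod_cast hb
    have ha0 : (0 : ℝ) ≤ a := by positivity
    have hn : (0 : ℝ) < n + 1 := by positivity
    rw [div_le_iff₀ hn, sub_mul, one_mul, div_mul_cancel₀ _ hn.ne']
    linarith
  · have h1 : toSpace (fl b - fl a) - (((b : ℝ) - a) / (n + 1)) • d = F a - F b := by
      simp only [F, toSpace_sub, sub_div, sub_smul]
      abel
    rw [h1, ← dist_eq_norm]
    have h2 := hy a
    rw [hyab] at h2
    linarith [dist_triangle_right (F a) (F b) (y b), hy b]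

theorem IsObstacle.exists_bound_of_not_isBetween {O : Set (Space m)}
    (hO : IsObstacle O) :
    ∃ D : ℝ, ∀ i j : Lattice m, (∀ l, ¬ IsBetween O l i j) → ‖toSpace (j - i)‖ ≤ D := by
  obtain ⟨c, hc⟩ := hO.interior_nonempty
  obtain ⟨ε₀, hε₀, hball⟩ := Metric.mem_nhds_iff.1 (mem_interior_iff_mem_nhds.1 hc)
  obtain ⟨N, hN, hnear⟩ := exists_lattice_near m (lt_min hε₀ one_pos)
  refine ⟨N, fun i j hij => ?_⟩
  by_contra! hlong
  obtain ⟨τ, l, h1, h2, h3⟩ := hnear (toSpace (j - i))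
  -- Both ends of the step are at distance at least 1 from `τ • toSpace (j - i)`, while `l` is
  -- nearer than 1; so `l` is neither `0` nor `j - i`.
  have hNd : 1 ≤ (1 / N) * ‖toSpace (j - i)‖ := by
    rw [one_div, inv_mul_eq_div, one_le_div hN]; exact hlong.le
  have hN0 : 0 < 1 / N := by positivity
  have hτd : 1 ≤ ‖τ • toSpace (j - i)‖ := by
    rw [norm_smul, Real.norm_of_nonneg (by linarith)]
    exact hNd.trans (by gcongr)
  have hτd' : 1 ≤ ‖(1 - τ) • toSpace (j - i)‖ := by
    rw [norm_smul, Real.norm_of_nonneg (by linarith)]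
    exact hNd.trans (by gcongr; linarith)
  obtain ⟨h3a, h3b⟩ := lt_min_iff.1 h3
  refine hij (i + l) ⟨?_, ?_, c + toSpace (i + l), ?_, ?_⟩
  · intro h
    have hl : l = 0 := by simpa using h
    have h0 : toSpace l = 0 := by subst hl; ext; simp [toSpace]
    rw [h0, zero_sub, norm_neg] at h3b
    linarith
  · intro h
    have hl : l = j - i := by rw [← h]; abel
    rw [hl, ← one_smul ℝ (toSpace (j - i)), smul_smul, mul_one, ← sub_smul] at h3b
    linarith
  · exact mem_lift_iff.2 (by simpa using interior_subset hc)
  -- The approximation error `w` is absorbed by moving `c` to `c + w`, still in `O`: the translates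
  -- of this point by `i` and `j`, weighted `1 - τ` and `τ`, average to `c + toSpace (i + l)`.
  · set w := toSpace l - τ • toSpace (j - i) with hw
    have hcw : c + w ∈ O := hball (by simpa using h3a)
    have hi : c + w + toSpace i ∈ lift O i ∪ lift O j := Or.inl ⟨_, hcw, rfl⟩
    have hj : c + w + toSpace j ∈ lift O i ∪ lift O j := Or.inr ⟨_, hcw, rfl⟩
    have := (convex_convexHull ℝ (lift O i ∪ lift O j)) (subset_convexHull ℝ _ hi)
      (subset_convexHull ℝ _ hj) (a := 1 - τ) (b := τ) (by linarith) (by linarith) (by ring)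
    convert this using 1
    rw [hw, toSpace_sub, toSpace_add]
    module

/-! ### Uniform loss at a corner -/

theorem finite_norm_toSpace_le (R : ℝ) : {a : Lattice m | ‖toSpace a‖ ≤ R}.Finite := by
  refine (Set.finite_Icc (fun _ => -⌈R⌉ : Lattice m) (fun _ => ⌈R⌉)).subset fun a ha => ?_
  have h : ∀ j, |(a j : ℝ)| ≤ ⌈R⌉ := fun j =>
    ((PiLp.norm_apply_le (toSpace a) j).trans ha).trans (Int.le_ceil R)
  exact ⟨fun j => by exact_mod_cast (abs_le.1 (h j)).1,
    fun j => by exact_mod_cast (abs_le.1 (h j)).2⟩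

/-- The triangle inequality is uniformly strict for three compact sets such that no point of the
second lies between points of the other two. -/
theorem exists_triangle_defect {A B C : Set (Space m)} (hA : IsCompact A) (hB : IsCompact B)
    (hC : IsCompact C) (h : ∀ x ∈ A, ∀ y ∈ B, ∀ z ∈ C, ¬ Wbtw ℝ x y z) :
    ∃ δ > 0, ∀ x ∈ A, ∀ y ∈ B, ∀ z ∈ C, dist x z + δ ≤ dist x y + dist y z := by
  have hcont : Continuous fun p : Space m × Space m × Space m =>
      dist p.1 p.2.1 + dist p.2.1 p.2.2 - dist p.1 p.2.2 := by fun_prop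
  obtain ⟨δ, hδ, hmin⟩ := (hA.prod (hB.prod hC)).exists_forall_le' (a := (0 : ℝ))
    hcont.continuousOn (fun p hp => by
      have h1 := dist_triangle p.1 p.2.1 p.2.2
      have h2 := mt dist_add_dist_eq_iff.1 (h _ hp.1 _ hp.2.1 _ hp.2.2)
      exact sub_pos.2 (lt_of_le_of_ne h1 (Ne.symm h2)))
  refine ⟨δ, hδ, fun x hx y hy z hz => ?_⟩
  have := hmin (x, y, z) ⟨hx, hy, hz⟩
  simp only at this
  linarith

/-- Translating `i` to `0` leaves finitely many pairs `(j - i, k - i)`, so the smallest of their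
defects serves for all. -/
theorem IsObstacle.exists_uniform_triangle_defect {O : Set (Space m)} (hO : IsObstacle O)
    (R : ℝ) : ∃ δ > 0, ∀ i j k : Lattice m, j ≠ i → j ≠ k → ¬ IsBetween O j i k →
      ‖toSpace (j - i)‖ ≤ R → ‖toSpace (k - i)‖ ≤ R →
      ∀ x ∈ lift O i, ∀ y ∈ lift O j, ∀ z ∈ lift O k,
        dist x z + δ ≤ dist x y + dist y z := by
  have hlift : ∀ a : Lattice m, IsCompact (lift O a) := fun a =>
    hO.isCompact.image (by fun_prop : Continuous fun x : Space m => x + toSpace a)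
  have key : ∀ p : Lattice m × Lattice m, ∃ δ > 0,
      (∀ x ∈ O, ∀ y ∈ lift O p.1, ∀ z ∈ lift O p.2, ¬ Wbtw ℝ x y z) →
      ∀ x ∈ O, ∀ y ∈ lift O p.1, ∀ z ∈ lift O p.2, dist x z + δ ≤ dist x y + dist y z := by
    intro p
    by_cases h : ∀ x ∈ O, ∀ y ∈ lift O p.1, ∀ z ∈ lift O p.2, ¬ Wbtw ℝ x y z
    · obtain ⟨δ, hδ, h'⟩ := exists_triangle_defect hO.isCompact (hlift p.1) (hlift p.2) h
      exact ⟨δ, hδ, fun _ => h'⟩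
    -- A dummy value: the claim is vacuous for such pairs.
    · exact ⟨1, one_pos, fun h' => absurd h' h⟩
  choose δ hδ hkey using key
  have hfin := (finite_norm_toSpace_le (m := m) R).prod (finite_norm_toSpace_le (m := m) R)
  obtain ⟨δ₀, hδ₀, hle⟩ : ∃ δ₀ > 0, ∀ p ∈ {a : Lattice m | ‖toSpace a‖ ≤ R} ×ˢ
      {a : Lattice m | ‖toSpace a‖ ≤ R}, δ₀ ≤ δ p := by
    rcases Set.eq_empty_or_nonempty ({a : Lattice m | ‖toSpace a‖ ≤ R} ×ˢ
      {a : Lattice m | ‖toSpace a‖ ≤ R}) with h | h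
    · exact ⟨1, one_pos, by simp [h]⟩
    · obtain ⟨q, -, hq⟩ := Set.exists_min_image _ δ hfin h
      exact ⟨δ q, hδ q, hq⟩
  refine ⟨δ₀, hδ₀, fun i j k hji hjk hbtw hj hk x hx y hy z hz => ?_⟩
  have hmem : ∀ {a : Lattice m} {u : Space m},
      u ∈ lift O (a - i) ↔ u + toSpace i ∈ lift O a := by
    intro a u
    rw [mem_lift_iff, mem_lift_iff, toSpace_sub]
    congr! 1
    abel
  have := hkey (j - i, k - i) (fun x' hx' y' hy' z' hz' hw => hbtw ⟨hji, hjk,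
      y' + toSpace i, hmem.1 hy', ?_⟩) (x - toSpace i) (mem_lift_iff.1 hx)
      (y - toSpace i) (hmem.2 (by simpa using hy)) (z - toSpace i) (hmem.2 (by simpa using hz))
  · simp only [dist_sub_right] at this
    linarith [hle (j - i, k - i) ⟨hj, hk⟩]
  · have hw' : Wbtw ℝ (x' + toSpace i) (y' + toSpace i) (z' + toSpace i) := by
      simpa only [vadd_eq_add] using (wbtw_vadd_const_iff (R := ℝ) (toSpace i)).2 hw
    have hx'' : x' + toSpace i ∈ lift O i ∪ lift O k := Or.inl ⟨x', hx', rfl⟩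
    have hz'' : z' + toSpace i ∈ lift O i ∪ lift O k := Or.inr (hmem.1 hz')
    exact segment_subset_convexHull hx'' hz'' hw'.mem_segment

/-! ### Loss of speed along admissible paths -/

/-- If every other corner is cut by at least `δ`, the displacement is smaller than the length by
a definite amount per segment. -/
theorem norm_sub_le_pathLength_sub {δ : ℝ} (s : ℕ) (x : ℕ → Space m)
    (h : ∀ n, n + 2 ≤ s → dist (x n) (x (n + 2)) + δ ≤
      dist (x n) (x (n + 1)) + dist (x (n + 1)) (x (n + 2))) :
    ‖x s - x 0‖ ≤ pathLength s x - δ * (s / 2 : ℕ) := by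
  induction s using Nat.strong_induction_on with
  | _ s ih =>
    match s, ih, h with
    | 0, _, _ => simp [pathLength]
    | 1, _, _ => simp [pathLength]
    | s + 2, ih, h =>
      -- Induction by two segments, so that the corners cut do not overlap.
      have h1 := ih s (by omega) fun n hn => h n (by omega)
      have h2 := h s le_rfl
      have h3 := dist_triangle_left (x (s + 2)) (x 0) (x s)
      have h4 : (s + 2) / 2 = s / 2 + 1 := by omega
      rw [h4, pathLength, Finset.sum_range_succ, Finset.sum_range_succ, ← pathLength]
      rw [dist_comm (x s) (x (s + 2)), dist_comm (x s) (x (s + 1)),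
        dist_comm (x (s + 1)) (x (s + 2))] at h2
      rw [dist_comm (x s) (x (s + 2))] at h3
      simp only [dist_eq_norm] at h2 h3
      push_cast
      linarith

theorem HasType.mem_lift {O : Set (Space m)} (hO : IsObstacle O) {s : ℕ}
    {x : ℕ → Space m} {k : ℕ → Lattice m} (ht : HasType O s x k) :
    ∀ n ≤ s, x n ∈ lift O (k n) := by
  intro n hn
  apply hO.frontier_lift_subset
  obtain ⟨h0, hs, hr⟩ := ht
  rcases n with _ | n
  · exact h0
  · rcases hn.eq_or_lt with rfl | hlt
    · exact hs
    · obtain ⟨ν, hν, -⟩ := hr n hlt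
      exact hν.1

theorem IsObstacle.admissibleRotationSet_subset_ball {O : Set (Space m)}
    (hO : IsObstacle O) : admissibleRotationSet O ⊆ Metric.ball 0 1 := by
  rintro v ⟨s, x, hP, ht, hv⟩
  obtain ⟨D, hD⟩ := hO.exists_bound_of_not_isBetween
  -- `k (i + 2) - k i` is a sum of two steps, each of norm at most `D`.
  obtain ⟨δ, hδ, hdefect⟩ := hO.exists_uniform_triangle_defect (2 * D)
  obtain ⟨M, hM⟩ := Metric.isBounded_iff.1 hO.isCompact.isBounded
  let L := max (M + D) 1
  have hL : 0 < L := lt_of_lt_of_le one_pos (le_max_right _ _)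
  have hbound : ∀ n, ‖x n (s n) - x n 0‖ ≤
      pathLength (s n) (x n) - δ * ((pathLength (s n) (x n) / L - 1) / 2) := by
    intro n
    obtain ⟨-, k, ⟨-, hne, hbtw, hbtw'⟩, htype⟩ := hP n
    have hmem := htype.mem_lift hO
    have hstep : ∀ i < s n, ‖x n (i + 1) - x n i‖ ≤ L := by
      intro i hi
      have h1 := hM (mem_lift_iff.1 (hmem (i + 1) hi)) (mem_lift_iff.1 (hmem i hi.le))
      have h2 := hD (k i) (k (i + 1)) (hbtw i hi)
      have h3 : x n (i + 1) - x n i = ((x n (i + 1) - toSpace (k (i + 1))) -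
          (x n i - toSpace (k i))) + toSpace (k (i + 1) - k i) := by
        rw [toSpace_sub]; abel
      rw [dist_eq_norm] at h1
      rw [h3]
      exact (norm_add_le _ _).trans ((add_le_add h1 h2).trans (le_max_left _ _))
    have hlen : pathLength (s n) (x n) ≤ s n * L := by
      simpa [pathLength] using
        Finset.sum_le_card_nsmul (Finset.range (s n)) (fun i => ‖x n (i + 1) - x n i‖) L
          fun i hi => hstep i (Finset.mem_range.1 hi)
    have hmain := norm_sub_le_pathLength_sub (δ := δ) (s n) (x n) fun i hi => by
      have h1 := hD (k i) (k (i + 1)) (hbtw i (by omega))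
      have h2 := hD (k (i + 1)) (k (i + 2)) (hbtw (i + 1) (by omega))
      refine hdefect (k i) (k (i + 1)) (k (i + 2)) (hne i (by omega))
        (hne (i + 1) (by omega)).symm (hbtw' i hi) ?_ ?_ _ (hmem i (by omega)) _
        (hmem (i + 1) (by omega)) _ (hmem (i + 2) hi)
      · linarith [norm_nonneg (toSpace (k (i + 1) - k i))]
      · rw [← sub_add_sub_cancel (k (i + 2)) (k (i + 1)) (k i), toSpace_add]
        linarith [norm_add_le (toSpace (k (i + 2) - k (i + 1))) (toSpace (k (i + 1) - k i))]
    refine hmain.trans (sub_le_sub_left (mul_le_mul_of_nonneg_left ?_ hδ.le) _)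
    have h1 : pathLength (s n) (x n) / L ≤ s n := (div_le_iff₀ hL).2 hlen
    have h2 : (s n : ℝ) ≤ 2 * (s n / 2 : ℕ) + 1 := by
      exact_mod_cast (by omega : s n ≤ 2 * (s n / 2) + 1)
    linarith
  have hlim : Tendsto (fun n => 1 - δ / (2 * L) + δ / 2 * (pathLength (s n) (x n))⁻¹) atTop
      (𝓝 (1 - δ / (2 * L) + δ / 2 * 0)) :=
    (ht.inv_tendsto_atTop.const_mul _).const_add _
  have hle : ‖v‖ ≤ 1 - δ / (2 * L) + δ / 2 * 0 := by
    refine le_of_tendsto_of_tendsto hv.norm hlim ?_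
    filter_upwards [ht.eventually_gt_atTop 0] with n hn
    rw [norm_smul, norm_inv, Real.norm_of_nonneg hn.le, inv_mul_le_iff₀ hn]
    refine (hbound n).trans (le_of_eq ?_)
    field_simp
    ring
  have : 0 < δ / (2 * L) := by positivity
  rw [mem_ball_zero_iff]
  linarith

/-! ### A free coordinate direction -/

/-- A coordinate direction is free: the line through a point at distance `1 / 2` from the centre
of the ball containing the obstacle avoids all obstacles. -/
theorem single_mem_rotationSet {O : Set (Space m)} (hsmall : IsSmall O) {i j : Fin m}
    (hij : i ≠ j) : EuclideanSpace.single i (1 : ℝ) ∈ rotationSet O := by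
  obtain ⟨c, r, hr, hO⟩ := hsmall
  have hr' : r < 1 / 2 := by
    nlinarith [Real.sq_sqrt (show (0 : ℝ) ≤ 2 by norm_num), Real.sqrt_nonneg 2]
  let p : Space m := c + EuclideanSpace.single j (1 / 2 : ℝ)
  let e : Space m := EuclideanSpace.single i (1 : ℝ)
  have he : ‖e‖ = 1 := by simp [e]
  let x : ℕ → ℕ → Space m := fun n t => p + ((t : ℝ) * (n + 1)) • e
  have hpos : ∀ n : ℕ, (0 : ℝ) < n + 1 := fun n => by positivity
  have hlen : ∀ n, pathLength 1 (x n) = n + 1 := by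
    intro n
    simp [pathLength, x, norm_smul, he, abs_of_pos (hpos n)]
  refine ⟨fun _ => 1, x, fun n => ⟨le_rfl, fun t ht => ⟨?_, fun k => ?_⟩,
    fun t ht => absurd ht (by simp)⟩, ?_, ?_⟩
  · obtain rfl : t = 0 := Nat.lt_one_iff.1 ht
    intro h
    have h1 := hlen n
    rw [pathLength, Finset.sum_range_one, ← h, sub_self, norm_zero] at h1
    exact (hpos n).ne h1
  · rw [Set.disjoint_left]
    intro q hq hqO
    have hqj : q j = c j + 1 / 2 := by
      obtain ⟨a, b, -, -, hab, rfl⟩ := hq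
      simp [x, p, e, hij.symm]
      linear_combination (c j + 1 / 2) * hab
    have h1 := hO (mem_lift_iff.1 (interior_subset hqO))
    rw [mem_closedBall_iff_norm] at h1
    have h2 := (PiLp.norm_apply_le _ j).trans h1
    have h3 : (q - toSpace k - c) j = 1 / 2 - k j := by
      simp [hqj, toSpace]; ring
    rw [h3, Real.norm_eq_abs] at h2
    obtain ⟨h4, h5⟩ := abs_le.1 h2
    -- A common point would put the integer `k j` within `r < 1 / 2` of `1 / 2`.
    have h6 : (0 : ℝ) < k j := by linarith
    have h7 : (k j : ℝ) < 1 := by linarith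
    norm_cast at h6 h7
    omega
  · simp only [hlen]
    exact tendsto_atTop_add_const_right _ _ tendsto_natCast_atTop_atTop
  · refine tendsto_const_nhds.congr fun n => ?_
    rw [hlen]
    simp [x, smul_smul, inv_mul_cancel₀ (hpos n).ne', e]

end TorusBilliard

theorem mainTheorem9 (m : ℕ) (hm : 2 ≤ m) (O : Set (TorusBilliard.Space m))
    (hO : TorusBilliard.IsObstacle O) (hsmall : TorusBilliard.IsSmall O) :
    TorusBilliard.admissibleRotationSet O ⊆ Metric.ball 0 1 ∧
    EuclideanSpace.single (⟨0, by omega⟩ : Fin m) (1 : ℝ) ∈ TorusBilliard.rotationSet O ∧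
    TorusBilliard.admissibleRotationSet O ≠ TorusBilliard.rotationSet O := by
  have hR : EuclideanSpace.single (⟨0, by omega⟩ : Fin m) (1 : ℝ) ∈ TorusBilliard.rotationSet O :=
    TorusBilliard.single_mem_rotationSet hsmall (j := ⟨1, by omega⟩) (by simp)
  have hAR := hO.admissibleRotationSet_subset_ball
  refine ⟨hAR, hR, fun h => ?_⟩
  have := hAR (h ▸ hR)
  simp at this
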